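/- Let $\mathcal X\subseteq\mathbb R^d$ be Lebesgue measurable, equipped with the $\sigma$-algebra of its Lebesgue-measurable subsets and Lebesgue measure. Let $\pi$ be a probability density on $\mathcal X$ (the same letter denotes the corresponding distribution), let $\hat\pi:\mathcal X\to[0,\infty)$ be measurable (an approximation to $\pi$), and let $q$ be any proposal density: $q\ge 0$ is measurable on $\mathcal X\times\mathcal X$ and $\int_{\mathcal X} q(x,y)\,dy=1$ for every $x$. For an acceptance probability $\alpha$ let $$P_\alpha(x,dy)=q(x,y)\,\alpha(x,y)\,dy+\Big[1-\int_{\mathcal X} q(x,z)\,\alpha(x,z)\,dz\Big]\delta_x(dy).$$ The Metropolis–Hastings kernel $P_{MH}$ is $P_\alpha$ with $$\alpha(x,y)=1\wedge\frac{\pi(y)q(y,x)}{\pi(x)q(x,y)},$$ and the delayed-acceptance kernel $P_{DA}$ is $P_\alpha$ with $$\alpha(x,y)=\Big[1\wedge\frac{\hat\pi(y)q(y,x)}{\hat\pi(x)q(x,y)}\Big]\Big[1\wedge\frac{\pi(y)/\hat\pi(y)}{\pi(x)/\hat\pi(x)}\Big]$$ (quotients with zero denominator are read as $0$). A Markov kernel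 $P$ with stationary distribution $\pi$ is called variance bounding if for every $h\in L^2(\pi)$ the asymptotic variance $$\lim_{n\to\infty} n\,\mathrm{Var}\Big[\frac1n\sum_{i=1}^n h(X_i)\Big]$$ exists and is finite, where $(X_i)_{i\ge1}$ is the Markov chain with kernel $P$ and $X_1\sim\pi$. Suppose that there exist $\gamma_{lo}>0$ and $\gamma_{hi}<\infty$ such that $\gamma_{lo}\le\hat\pi(x)/\pi(x)\le\gamma_{hi}$ for every $x\in\mathcal X$ with $\pi(x)>0$. If $P_{MH}$ is variance bounding, then so is $P_{DA}$. -/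

import Mathlib

open MeasureTheory ProbabilityTheory Filter Topology

namespace DelayedAcceptance

/-! ### The state space -/

/-- The state space `𝒳 ⊆ ℝ^d`, as a type of its own (so that it can carry the Lebesgue
`σ`-algebra rather than the Borel one). -/
def StateSpace {d : ℕ} (X : Set (EuclideanSpace ℝ (Fin d))) : Type := ↥X

/-- The inclusion of `𝒳` into `ℝ^d`, where `ℝ^d` carries the `σ`-algebra of all Lebesgue measurable
(i.e. null measurable) sets. -/
def StateSpace.incl {d : ℕ} (X : Set (EuclideanSpace ℝ (Fin d))) :
    StateSpace X → NullMeasurableSpace (EuclideanSpace ℝ (Fin d)) volume :=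
  fun x => Subtype.val (p := fun y => y ∈ X) x

/-- `𝒳` carries the trace of the Lebesgue `σ`-algebra of `ℝ^d` (for Lebesgue measurable `𝒳`: all
Lebesgue measurable subsets of `𝒳`) and the restriction of Lebesgue measure. -/
noncomputable instance {d : ℕ} (X : Set (EuclideanSpace ℝ (Fin d))) :
    MeasureSpace (StateSpace X) where
  toMeasurableSpace := MeasurableSpace.comap (StateSpace.incl X) inferInstance
  volume := @Measure.comap _ _ (MeasurableSpace.comap (StateSpace.incl X) inferInstance) _
    (StateSpace.incl X) (Measure.completion volume)

theorem StateSpace.measurable_incl {d : ℕ} (X : Set (EuclideanSpace ℝ (Fin d))) :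
    Measurable (StateSpace.incl X) := comap_measurable _

theorem sigmaFinite_comap {α β : Type*} [MeasurableSpace α] [MeasurableSpace β] {f : α → β}
    (hf : Measurable f) (ν : Measure β) [SigmaFinite ν] : SigmaFinite (ν.comap f) := by
  refine ⟨⟨⟨fun n => f ⁻¹' spanningSets ν n, fun _ => trivial, fun n => ?_, ?_⟩⟩⟩
  · refine lt_of_le_of_lt (Measure.comap_apply_le f ν
      (hf (measurableSet_spanningSets ν n)).nullMeasurableSet) ?_
    exact lt_of_le_of_lt (measure_mono (Set.image_preimage_subset _ _))
      (measure_spanningSets_lt_top ν n)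
  · rw [← Set.preimage_iUnion, iUnion_spanningSets, Set.preimage_univ]

theorem sigmaFinite_completion {α : Type*} [MeasurableSpace α] (μ : Measure α) [SigmaFinite μ] :
    SigmaFinite μ.completion := by
  have h1 : ∀ n, μ (spanningSets μ n) < ⊤ := measure_spanningSets_lt_top μ
  have h2 : (⋃ n, spanningSets μ n) = Set.univ := iUnion_spanningSets μ
  generalize spanningSets μ = T at h1 h2
  exact ⟨⟨⟨T, fun _ => trivial, h1, h2⟩⟩⟩

instance {d : ℕ} (X : Set (EuclideanSpace ℝ (Fin d))) :
    SigmaFinite (volume : Measure (StateSpace X)) :=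
  have := sigmaFinite_completion (volume : Measure (EuclideanSpace ℝ (Fin d)))
  sigmaFinite_comap (StateSpace.measurable_incl X) _

/-! ### Densities, proposals and propose-accept-reject kernels -/

/-- A density, not necessarily normalised: a measurable function with values in `[0, ∞)`. -/
structure Density (S : Type*) [MeasurableSpace S] where
  toFun : S → ℝ
  measurable : Measurable toFun
  nonneg : ∀ x, 0 ≤ toFun x

instance (S : Type*) [MeasurableSpace S] : CoeFun (Density S) (fun _ => S → ℝ) := ⟨Density.toFun⟩

/-- The distribution with a given density. -/
noncomputable def Density.toMeasure {S : Type*} [MeasureSpace S] (π : Density S) : Measure S :=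
  (volume : Measure S).withDensity (fun x => ENNReal.ofReal (π x))

/-- A proposal density: `q x` is a probability density for each `x`, measurable in `(x, y)`. -/
structure Proposal (S : Type*) [MeasureSpace S] where
  toFun : S → S → ℝ
  measurable : Measurable (Function.uncurry toFun)
  nonneg : ∀ x y, 0 ≤ toFun x y
  integral_eq_one : ∀ x, ∫ y, toFun x y = 1

instance (S : Type*) [MeasureSpace S] : CoeFun (Proposal S) (fun _ => S → S → ℝ) :=
  ⟨Proposal.toFun⟩

/-- An acceptance probability: a measurable function of `(x, y)` with values in `[0, 1]`. -/
structure Acceptance (S : Type*) [MeasurableSpace S] where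
  toFun : S → S → ℝ
  measurable : Measurable (Function.uncurry toFun)
  nonneg : ∀ x y, 0 ≤ toFun x y
  le_one : ∀ x y, toFun x y ≤ 1

instance (S : Type*) [MeasurableSpace S] : CoeFun (Acceptance S) (fun _ => S → S → ℝ) :=
  ⟨Acceptance.toFun⟩

/-- The propose-accept-reject kernel
`P(x, dy) = q(x, y) α(x, y) dy + [1 - ∫ q(x, y) α(x, y) dy] δ_x(dy)`. -/
noncomputable def kernel {S : Type*} [MeasureSpace S] [SFinite (volume : Measure S)]
    (q : Proposal S) (α : Acceptance S) : Kernel S S where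
  toFun x := (volume : Measure S).withDensity (fun y => ENNReal.ofReal (q x y * α x y))
    + ENNReal.ofReal (1 - ∫ y, q x y * α x y) • Measure.dirac x
  measurable' := by
    have h1 : Measurable (Function.uncurry fun x y => q x y * α x y) :=
      q.measurable.mul α.measurable
    refine Measure.measurable_of_measurable_coe _ fun A hA => ?_
    simp only [Measure.add_apply, Measure.smul_apply, withDensity_apply _ hA,
      Measure.dirac_apply' _ hA, smul_eq_mul]
    refine Measurable.add ?_ (Measurable.mul ?_ ?_)
    · exact h1.ennreal_ofReal.lintegral_prod_right'
    · exact (measurable_const.sub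
        h1.stronglyMeasurable.integral_prod_right.measurable).ennreal_ofReal
    · exact measurable_one.indicator hA

instance {S : Type*} [MeasureSpace S] [SFinite (volume : Measure S)]
    (q : Proposal S) (α : Acceptance S) : IsMarkovKernel (kernel q α) := by
  refine ⟨fun x => ⟨?_⟩⟩
  have hqi : Integrable (fun y => q x y) := by
    by_contra h
    have := q.integral_eq_one x
    rw [integral_undef h] at this
    exact zero_ne_one this
  have hm : Measurable (fun y => q x y * α x y) :=
    (q.measurable.mul α.measurable).comp measurable_prodMk_left
  have h0 : ∀ y, 0 ≤ q x y * α x y := fun y => mul_nonneg (q.nonneg x y) (α.nonneg x y)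
  have hle : ∀ y, q x y * α x y ≤ q x y := fun y =>
    mul_le_of_le_one_right (q.nonneg x y) (α.le_one x y)
  have hi : Integrable (fun y => q x y * α x y) :=
    hqi.mono' hm.aestronglyMeasurable
      (Eventually.of_forall fun y => by rw [Real.norm_of_nonneg (h0 y)]; exact hle y)
  have hI : ∫ y, q x y * α x y ≤ 1 := by
    rw [← q.integral_eq_one x]
    exact integral_mono hi hqi hle
  have hI0 : 0 ≤ ∫ y, q x y * α x y := integral_nonneg h0
  change ((volume : Measure S).withDensity (fun y => ENNReal.ofReal (q x y * α x y))
    + ENNReal.ofReal (1 - ∫ y, q x y * α x y) • Measure.dirac x) Set.univ = 1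
  rw [Measure.add_apply, Measure.smul_apply, withDensity_apply _ MeasurableSet.univ,
    Measure.restrict_univ, ← ofReal_integral_eq_lintegral_ofReal hi (Eventually.of_forall h0),
    measure_univ, smul_eq_mul, mul_one, ← ENNReal.ofReal_add hI0 (sub_nonneg.2 hI)]
  simp

/-! ### Metropolis-Hastings and delayed acceptance

Quotients with a vanishing denominator are `0` here. Such a convention only concerns moves that are
proposed with density zero, and points `x` with `π x = 0` (a null set of the target) or with
`πhat x = 0`. -/

/-- `r_MH(x, y) = π(y) q(y, x) / (π(x) q(x, y))`. -/
noncomputable def ratioMH {S : Type*} [MeasureSpace S] (π : Density S) (q : Proposal S)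
    (x y : S) : ℝ :=
  (π y * q y x) / (π x * q x y)

/-- `r_2(x, y) = (π(y) / πhat(y)) / (π(x) / πhat(x))`, the ratio of the correction stage. -/
noncomputable def ratioCorrection {S : Type*} [MeasureSpace S] (π πhat : Density S)
    (x y : S) : ℝ :=
  (π y / πhat y) / (π x / πhat x)

theorem Proposal.measurable_swap {S : Type*} [MeasureSpace S] (q : Proposal S) :
    Measurable (fun p : S × S => q p.2 p.1) := q.measurable.comp _root_.measurable_swap

theorem measurable_ratioMH {S : Type*} [MeasureSpace S] (π : Density S) (q : Proposal S) :
    Measurable (fun p : S × S => ratioMH π q p.1 p.2) :=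
  ((π.measurable.comp measurable_snd).mul q.measurable_swap).div
    ((π.measurable.comp measurable_fst).mul q.measurable)

theorem measurable_ratioCorrection {S : Type*} [MeasureSpace S] (π πhat : Density S) :
    Measurable (fun p : S × S => ratioCorrection π πhat p.1 p.2) :=
  ((π.measurable.comp measurable_snd).div (πhat.measurable.comp measurable_snd)).div
    ((π.measurable.comp measurable_fst).div (πhat.measurable.comp measurable_fst))

theorem ratioMH_nonneg {S : Type*} [MeasureSpace S] (π : Density S) (q : Proposal S) (x y : S) :
    0 ≤ ratioMH π q x y :=
  div_nonneg (mul_nonneg (π.nonneg y) (q.nonneg y x)) (mul_nonneg (π.nonneg x) (q.nonneg x y))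

theorem ratioCorrection_nonneg {S : Type*} [MeasureSpace S] (π πhat : Density S) (x y : S) :
    0 ≤ ratioCorrection π πhat x y :=
  div_nonneg (div_nonneg (π.nonneg y) (πhat.nonneg y)) (div_nonneg (π.nonneg x) (πhat.nonneg x))

/-- `α_MH(x, y) = 1 ∧ r_MH(x, y)`. -/
noncomputable def acceptMH {S : Type*} [MeasureSpace S] (π : Density S) (q : Proposal S) :
    Acceptance S where
  toFun x y := min 1 (ratioMH π q x y)
  measurable := measurable_const.min (measurable_ratioMH π q)
  nonneg x y := le_min zero_le_one (ratioMH_nonneg π q x y)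
  le_one _ _ := min_le_left _ _

/-- `α_DA(x, y) = [1 ∧ r_1(x, y)] [1 ∧ r_2(x, y)]`, where the ratio `r_1` of the screening stage is
the Metropolis-Hastings ratio with `πhat` in place of `π`. -/
noncomputable def acceptDA {S : Type*} [MeasureSpace S] (π πhat : Density S) (q : Proposal S) :
    Acceptance S where
  toFun x y := min 1 (ratioMH πhat q x y) * min 1 (ratioCorrection π πhat x y)
  measurable := (measurable_const.min (measurable_ratioMH πhat q)).mul
    (measurable_const.min (measurable_ratioCorrection π πhat))
  nonneg x y := mul_nonneg (le_min zero_le_one (ratioMH_nonneg πhat q x y))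
    (le_min zero_le_one (ratioCorrection_nonneg π πhat x y))
  le_one x y := mul_le_one₀ (min_le_left _ _)
    (le_min zero_le_one (ratioCorrection_nonneg π πhat x y)) (min_le_left _ _)

/-- The Metropolis-Hastings kernel with target density `π` and proposal `q`. -/
noncomputable def kernelMH {S : Type*} [MeasureSpace S] [SFinite (volume : Measure S)]
    (π : Density S) (q : Proposal S) : Kernel S S :=
  kernel q (acceptMH π q)

/-- The delayed-acceptance kernel with target density `π`, approximation `πhat` and
proposal `q`. -/
noncomputable def kernelDA {S : Type*} [MeasureSpace S] [SFinite (volume : Measure S)]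
    (π πhat : Density S) (q : Proposal S) : Kernel S S :=
  kernel q (acceptDA π πhat q)

instance {S : Type*} [MeasureSpace S] [SFinite (volume : Measure S)]
    (π : Density S) (q : Proposal S) : IsMarkovKernel (kernelMH π q) :=
  inferInstanceAs (IsMarkovKernel (kernel q (acceptMH π q)))

instance {S : Type*} [MeasureSpace S] [SFinite (volume : Measure S)]
    (π πhat : Density S) (q : Proposal S) : IsMarkovKernel (kernelDA π πhat q) :=
  inferInstanceAs (IsMarkovKernel (kernel q (acceptDA π πhat q)))

/-! ### Asymptotic variance and variance bounding -/

/-- The law on `ℕ → S` of the homogeneous Markov chain with initial distribution `μ` and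
transition kernel `P`. -/
noncomputable def chainLaw {S : Type*} [MeasurableSpace S] (μ : Measure S) (P : Kernel S S)
    [IsMarkovKernel P] : Measure (ℕ → S) :=
  Kernel.trajMeasure (X := fun _ => S) μ
    (fun n => P.comap (fun ω : (Π _ : Finset.Iic n, S) => ω ⟨n, Finset.mem_Iic.2 le_rfl⟩)
      (measurable_pi_apply _))

/-- The asymptotic variance of `h` along the chain with kernel `P` started from `μ`
exists and equals the (finite) number `v`: `n Var[(1/n) ∑_{i=1}^n h(X_i)] → v`, with the chain
`X_1, X_2, …` written as `ω 0, ω 1, …`. -/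
def HasAsymptoticVariance {S : Type*} [MeasurableSpace S] (P : Kernel S S) [IsMarkovKernel P]
    (μ : Measure S) (h : S → ℝ) (v : ℝ) : Prop :=
  Tendsto (fun n : ℕ => (n : ℝ) *
    variance (fun ω : ℕ → S => (1 / (n : ℝ)) * ∑ i ∈ Finset.range n, h (ω i)) (chainLaw μ P))
    atTop (𝓝 v)

/-- A Markov kernel with stationary distribution `μ` is variance bounding if every
`h ∈ L²(μ)` has a finite asymptotic variance. -/
def VarianceBounding {S : Type*} [MeasurableSpace S] (P : Kernel S S) [IsMarkovKernel P]
    (μ : Measure S) : Prop :=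
  Kernel.Invariant P μ ∧ ∀ h : S → ℝ, MemLp h 2 μ → ∃ v : ℝ, HasAsymptoticVariance P μ h v

end DelayedAcceptance

/-!
The transition operator `P` of a stationary reversible chain is a self-adjoint contraction of
`L²(π)`, and for centred `h` the variance of `h(X₁) + ⋯ + h(Xₙ)` is the quadratic form at `h` of
`Sₙ = ∑_{i,j ≤ n} P ^ |i - j|`. If `⟪h, Sₙ h⟫ / n` converges for every `h`, then by the uniform
boundedness principle the operators `Sₙ / n` are uniformly bounded, say by `C`. Since
`‖h - P ^ k h‖ ≤ k ‖h - P h‖`, an almost invariant `h` would make `⟪h, Sₙ h⟫` almost `n² ‖h‖²`,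
which is impossible for `n > C`; so `P` has a spectral gap on the centred functions. Conversely, a
gap makes `1 - P` invertible, and `Sₙ (1 - P)² = n (1 + P) (1 - P) - 2 (P - P ^ (n + 1))` yields the
limit of `Sₙ / n`.

A spectral gap bounds the Dirichlet form from below, so it passes to every reversible kernel whose
Dirichlet form is at least a positive multiple of the given one. For propose-accept-reject kernels
the Dirichlet forms compare if the densities `π(x) q(x, y) α(x, y)` of the accepted moves do. For
Metropolis-Hastings this density is `π(x) q(x, y) ∧ π(y) q(y, x)`; for delayed acceptance it is the
Metropolis-Hastings one with target `πhat`, times `(π(x) / πhat(x)) ∧ (π(y) / πhat(y))`, hence at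
least `γlo / γhi` times the former.
-/

namespace DelayedAcceptance

open scoped InnerProductSpace ENNReal NNReal

section PowerSums

/-- The sum `∑_{i,j < n} P ^ |i - j|`. When `P` is the transition operator of a stationary
reversible chain on the centred functions, its quadratic form is the variance of
`h(X_1) + ⋯ + h(X_n)`. -/
def covSum {R : Type*} [Semiring R] (P : R) (n : ℕ) : R :=
  ∑ i ∈ Finset.range n, ∑ j ∈ Finset.range n, P ^ Nat.dist i j

theorem sum_pow_dist_right {R : Type*} [Semiring R] (P : R) (n : ℕ) :
    ∑ i ∈ Finset.range n, P ^ Nat.dist i n = ∑ k ∈ Finset.range n, P ^ (k + 1) := by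
  rw [← Finset.sum_range_reflect]
  refine Finset.sum_congr rfl fun k hk => ?_
  have hk : k < n := Finset.mem_range.1 hk
  rw [Nat.dist_eq_sub_of_le (by omega)]
  congr 1
  omega

theorem covSum_succ {R : Type*} [Semiring R] (P : R) (n : ℕ) :
    covSum P (n + 1) = covSum P n + (1 + 2 • ∑ k ∈ Finset.range n, P ^ (k + 1)) := by
  simp only [covSum, Finset.sum_range_succ, Finset.sum_add_distrib, Nat.dist_self, pow_zero]
  simp only [Nat.dist_comm n, sum_pow_dist_right]
  abel

theorem sum_pow_succ_mul_one_sub {R : Type*} [Ring R] (P : R) (n : ℕ) :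
    (∑ k ∈ Finset.range n, P ^ (k + 1)) * (1 - P) = P - P ^ (n + 1) := by
  simp_rw [pow_succ', ← Finset.mul_sum, mul_assoc, geom_sum_mul_neg, mul_sub, mul_one]

theorem covSum_mul_one_sub {R : Type*} [Ring R] (P : R) (n : ℕ) :
    covSum P n * (1 - P) = n • (1 + P) - 2 • ∑ k ∈ Finset.range n, P ^ (k + 1) := by
  induction n with
  | zero => simp [covSum]
  | succ n ih =>
    rw [covSum_succ, add_mul, ih, add_mul, one_mul, smul_mul_assoc, sum_pow_succ_mul_one_sub,
      Finset.sum_range_succ, succ_nsmul (1 + P)]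
    abel

theorem covSum_mul_one_sub_sq {R : Type*} [Ring R] (P : R) (n : ℕ) :
    covSum P n * (1 - P) ^ 2 = n • ((1 + P) * (1 - P)) - 2 • (P - P ^ (n + 1)) := by
  rw [pow_two, ← mul_assoc, covSum_mul_one_sub, sub_mul, smul_mul_assoc, smul_mul_assoc,
    sum_pow_succ_mul_one_sub]

theorem sub_pow_succ_of_mul_eq {R : Type*} [Ring R] {T J : R} (hJ : IsIdempotentElem J)
    (hTJ : T * J = J) (hJT : J * T = J) (n : ℕ) : (T - J) ^ (n + 1) = T ^ (n + 1) - J := by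
  have hpow (k : ℕ) : T ^ k * J = J := by
    induction k with
    | zero => rw [pow_zero, one_mul]
    | succ k ih => rw [pow_succ, mul_assoc, hTJ, ih]
  induction n with
  | zero => simp only [zero_add, pow_one]
  | succ n ih =>
    rw [pow_succ, ih, sub_mul, mul_sub, mul_sub, hpow, hJT, hJ.eq, ← pow_succ, sub_self, sub_zero]

theorem isSelfAdjoint_covSum {R : Type*} [Semiring R] [StarRing R] {P : R} (hP : IsSelfAdjoint P)
    (n : ℕ) : IsSelfAdjoint (covSum P n) :=
  isSelfAdjoint_sum _ fun _ _ => isSelfAdjoint_sum _ fun _ _ => hP.pow _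

theorem tendsto_inv_smul_covSum {A : Type*} [NormedRing A] [NormedAlgebra ℝ A] {P : A}
    (hP : ‖P‖ ≤ 1) {u : Aˣ} (hu : (u : A) = 1 - P) :
    Tendsto (fun n : ℕ => (n : ℝ)⁻¹ • covSum P n) atTop (𝓝 ((1 + P) * ↑u⁻¹)) := by
  have hbdd (n : ℕ) : ‖P - P ^ (n + 1)‖ ≤ 2 := by
    have hpow : ‖P ^ (n + 1)‖ ≤ 1 :=
      (norm_pow_le' P n.succ_pos).trans (pow_le_one₀ (norm_nonneg P) hP)
    linarith [norm_sub_le P (P ^ (n + 1))]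
  have hrem : Tendsto (fun n : ℕ => (n : ℝ)⁻¹ • (P - P ^ (n + 1))) atTop (𝓝 0) :=
    tendsto_inv_atTop_nhds_zero_nat.zero_smul_isBoundedUnder_le (isBoundedUnder_of ⟨2, hbdd⟩)
  have hlim := ((hrem.const_smul (2 : ℕ)).const_sub ((1 + P) * u)).mul_const ((↑u⁻¹ : A) ^ 2)
  have hlimit : ((1 + P) * u - 2 • (0 : A)) * (↑u⁻¹ : A) ^ 2 = (1 + P) * ↑u⁻¹ := by
    rw [smul_zero, sub_zero, mul_assoc, pow_two, u.mul_inv_cancel_left]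
  rw [hlimit] at hlim
  refine hlim.congr' ((eventually_ne_atTop 0).mono fun n hn => ?_)
  have hsq : covSum P n = (n • ((1 + P) * u) - 2 • (P - P ^ (n + 1))) * (↑u⁻¹ : A) ^ 2 := by
    rw [hu, ← covSum_mul_one_sub_sq, ← hu, ← Units.val_pow_eq_pow_val, ← Units.val_pow_eq_pow_val,
      inv_pow, Units.mul_inv_cancel_right]
  dsimp only
  rw [hsq, ← smul_mul_assoc, smul_sub _ (n • _), ← Nat.cast_smul_eq_nsmul ℝ n,
    inv_smul_smul₀ (Nat.cast_ne_zero.2 hn), smul_comm _ (2 : ℕ)]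

end PowerSums

section Contraction

variable {𝕜 E : Type*} [NontriviallyNormedField 𝕜] [SeminormedAddCommGroup E] [NormedSpace 𝕜 E]
  {P : E →L[𝕜] E}

theorem norm_apply_le_of_opNorm_le_one (hP : ‖P‖ ≤ 1) (x : E) : ‖P x‖ ≤ ‖x‖ :=
  (P.le_of_opNorm_le hP x).trans_eq (one_mul _)

theorem norm_sub_pow_apply_le (hP : ‖P‖ ≤ 1) (k : ℕ) (x : E) :
    ‖x - (P ^ k) x‖ ≤ k * ‖x - P x‖ := by
  induction k with
  | zero => simp
  | succ k ih =>
    have hsplit : x - (P ^ (k + 1)) x = (x - P x) + P (x - (P ^ k) x) := by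
      rw [pow_succ', mul_apply_eq_comp, map_sub]
      abel
    calc ‖x - (P ^ (k + 1)) x‖ ≤ ‖x - P x‖ + ‖P (x - (P ^ k) x)‖ := hsplit ▸ norm_add_le _ _
      _ ≤ ‖x - P x‖ + k * ‖x - P x‖ := by
          gcongr
          exact (norm_apply_le_of_opNorm_le_one hP _).trans ih
      _ = (k + 1 : ℕ) * ‖x - P x‖ := by push_cast; ring

end Contraction

section SpectralGap

/-- A spectral gap of `P` at `1`: the quadratic form of `1 - P` is bounded below by a positive
multiple of `‖x‖ ^ 2`. -/
def HasSpectralGap {E : Type*} [SeminormedAddCommGroup E] [InnerProductSpace ℝ E]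
    (P : E →L[ℝ] E) : Prop :=
  ∃ c > 0, ∀ x, c * ‖x‖ ^ 2 ≤ ⟪x, x - P x⟫_ℝ

variable {E : Type*} [SeminormedAddCommGroup E] [InnerProductSpace ℝ E] {P : E →L[ℝ] E}

theorem le_inner_pow_apply (hP : ‖P‖ ≤ 1) (k : ℕ) (x : E) :
    ‖x‖ ^ 2 - k * (‖x‖ * ‖x - P x‖) ≤ ⟪x, (P ^ k) x⟫_ℝ := by
  have hle : ⟪x, x - (P ^ k) x⟫_ℝ ≤ ‖x‖ * (k * ‖x - P x‖) :=
    (real_inner_le_norm _ _).trans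
      (mul_le_mul_of_nonneg_left (norm_sub_pow_apply_le hP k x) (norm_nonneg x))
  rw [inner_sub_right, real_inner_self_eq_norm_sq] at hle
  linarith

theorem le_inner_covSum_apply (hP : ‖P‖ ≤ 1) (n : ℕ) (x : E) :
    n ^ 2 * (‖x‖ ^ 2 - n * (‖x‖ * ‖x - P x‖)) ≤ ⟪x, covSum P n x⟫_ℝ := by
  have hterm : ∀ i ∈ Finset.range n, ∀ j ∈ Finset.range n,
      ‖x‖ ^ 2 - n * (‖x‖ * ‖x - P x‖) ≤ ⟪x, (P ^ Nat.dist i j) x⟫_ℝ := by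
    intro i hi j hj
    have hdist : Nat.dist i j ≤ n := by
      have := Finset.mem_range.1 hi
      have := Finset.mem_range.1 hj
      rw [Nat.dist]
      omega
    refine le_trans ?_ (le_inner_pow_apply hP _ x)
    gcongr
  simp only [covSum, sum_apply, inner_sum]
  calc (n : ℝ) ^ 2 * (‖x‖ ^ 2 - n * (‖x‖ * ‖x - P x‖))
      = ∑ _i ∈ Finset.range n, ∑ _j ∈ Finset.range n, (‖x‖ ^ 2 - n * (‖x‖ * ‖x - P x‖)) := by
        simp only [Finset.sum_const, Finset.card_range, nsmul_eq_mul]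
        ring
    _ ≤ _ := Finset.sum_le_sum fun i hi => Finset.sum_le_sum fun j hj => hterm i hi j hj

theorem norm_sub_apply_sq_le (hP : ‖P‖ ≤ 1) (x : E) : ‖x - P x‖ ^ 2 ≤ 2 * ⟪x, x - P x⟫_ℝ := by
  have hle := pow_le_pow_left₀ (norm_nonneg _) (norm_apply_le_of_opNorm_le_one hP x) 2
  rw [norm_sub_sq_real, inner_sub_right, real_inner_self_eq_norm_sq]
  linarith

theorem hasSpectralGap_of_norm_le {K : ℝ} (hP : ‖P‖ ≤ 1) (hK : 0 < K)
    (h : ∀ x, ‖x‖ ≤ K * ‖x - P x‖) : HasSpectralGap P := by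
  refine ⟨1 / (2 * K ^ 2), by positivity, fun x => ?_⟩
  rw [one_div_mul_eq_div, div_le_iff₀ (by positivity)]
  calc ‖x‖ ^ 2 ≤ (K * ‖x - P x‖) ^ 2 := pow_le_pow_left₀ (norm_nonneg x) (h x) 2
    _ = K ^ 2 * ‖x - P x‖ ^ 2 := mul_pow _ _ _
    _ ≤ K ^ 2 * (2 * ⟪x, x - P x⟫_ℝ) := by gcongr; exact norm_sub_apply_sq_le hP x
    _ = ⟪x, x - P x⟫_ℝ * (2 * K ^ 2) := by ring

theorem hasSpectralGap_of_inner_covSum_succ_le (hP : ‖P‖ ≤ 1) (n : ℕ)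
    (h : ∀ x, ⟪x, covSum P (n + 1) x⟫_ℝ ≤ (n + 1) * n * ‖x‖ ^ 2) : HasSpectralGap P := by
  refine hasSpectralGap_of_norm_le (K := (n + 1) ^ 2) hP (by positivity) fun x => ?_
  rcases (norm_nonneg x).eq_or_lt with hx | hx
  · rw [← hx]
    positivity
  have hle := (le_inner_covSum_apply hP (n + 1) x).trans (h x)
  push_cast at hle
  refine le_of_mul_le_mul_left ?_ (by positivity : 0 < (n + 1) * ‖x‖)
  linarith

theorem HasSpectralGap.of_inner_sub_le {Q : E →L[ℝ] E} {K : ℝ} (hP : HasSpectralGap P)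
    (hK : 0 < K) (h : ∀ x, ⟪x, x - P x⟫_ℝ ≤ K * ⟪x, x - Q x⟫_ℝ) : HasSpectralGap Q := by
  obtain ⟨c, hc, hgap⟩ := hP
  refine ⟨c / K, div_pos hc hK, fun x => ?_⟩
  rw [div_mul_eq_mul_div, div_le_iff₀' hK]
  exact (hgap x).trans (h x)

end SpectralGap

section HilbertSpace

variable {E : Type*} [NormedAddCommGroup E] [InnerProductSpace ℝ E] [CompleteSpace E]
  {P : E →L[ℝ] E}

/-- Polarisation turns pointwise bounds on the quadratic forms into weak boundedness, to which the
uniform boundedness principle applies twice. -/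
theorem exists_opNorm_le_of_forall_exists_abs_inner_le {ι : Type*} {A : ι → E →L[ℝ] E}
    (hA : ∀ i, IsSelfAdjoint (A i)) (h : ∀ x, ∃ C, ∀ i, |⟪x, A i x⟫_ℝ| ≤ C) :
    ∃ C, ∀ i, ‖A i‖ ≤ C := by
  have hpolar (i : ι) (x y : E) :
      4 * ⟪A i x, y⟫_ℝ = ⟪x + y, A i (x + y)⟫_ℝ - ⟪x - y, A i (x - y)⟫_ℝ := by
    have hsymm : ⟪x, A i y⟫_ℝ = ⟪A i x, y⟫_ℝ :=
      ((ContinuousLinearMap.isSelfAdjoint_iff_isSymmetric.1 (hA i)) x y).symm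
    simp only [map_add, map_sub, inner_add_left, inner_add_right, inner_sub_left, inner_sub_right,
      hsymm, real_inner_comm (A i x) y]
    ring
  have hweak (x y : E) : ∃ C, ∀ i, ‖innerSL ℝ (A i x) y‖ ≤ C := by
    obtain ⟨C₁, h₁⟩ := h (x + y)
    obtain ⟨C₂, h₂⟩ := h (x - y)
    refine ⟨(C₁ + C₂) / 4, fun i => ?_⟩
    rw [innerSL_apply_apply, Real.norm_eq_abs, le_div_iff₀ four_pos, mul_comm,
      ← Nat.abs_ofNat 4, ← abs_mul, hpolar]
    exact (abs_sub _ _).trans (add_le_add (h₁ i) (h₂ i))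
  refine banach_steinhaus fun x => ?_
  obtain ⟨C, hC⟩ := banach_steinhaus (hweak x)
  exact ⟨C, fun i => by simpa only [innerSL_apply_norm] using hC i⟩

theorem hasSpectralGap_of_forall_exists_tendsto (hP : IsSelfAdjoint P) (hP1 : ‖P‖ ≤ 1)
    (h : ∀ x, ∃ v, Tendsto (fun n : ℕ => (n : ℝ)⁻¹ * ⟪x, covSum P n x⟫_ℝ) atTop (𝓝 v)) :
    HasSpectralGap P := by
  obtain ⟨C, hC⟩ : ∃ C, ∀ n : ℕ, ‖(n : ℝ)⁻¹ • covSum P n‖ ≤ C := by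
    refine exists_opNorm_le_of_forall_exists_abs_inner_le
      (fun n => .smul (.all _) (isSelfAdjoint_covSum hP n)) fun x => ?_
    obtain ⟨v, hv⟩ := h x
    obtain ⟨C, hC⟩ := hv.abs.bddAbove_range
    refine ⟨C, fun n => ?_⟩
    rw [smul_apply, real_inner_smul_right]
    exact hC ⟨n, rfl⟩
  obtain ⟨n, hn⟩ := exists_nat_ge C
  have hn0 : ((n + 1 : ℕ) : ℝ) ≠ 0 := Nat.cast_ne_zero.2 n.succ_ne_zero
  refine hasSpectralGap_of_inner_covSum_succ_le hP1 n fun x => ?_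
  calc ⟪x, covSum P (n + 1) x⟫_ℝ
      = (n + 1 : ℕ) * ⟪x, (((n + 1 : ℕ) : ℝ)⁻¹ • covSum P (n + 1)) x⟫_ℝ := by
        rw [smul_apply, real_inner_smul_right, mul_inv_cancel_left₀ hn0]
    _ ≤ (n + 1 : ℕ) * (‖x‖ * (n * ‖x‖)) := by
        gcongr
        refine (real_inner_le_norm _ _).trans ?_
        gcongr
        exact ContinuousLinearMap.le_of_opNorm_le _ ((hC (n + 1)).trans hn) x
    _ = (n + 1) * n * ‖x‖ ^ 2 := by push_cast; ring

theorem HasSpectralGap.isUnit_one_sub (h : HasSpectralGap P) : IsUnit (1 - P) := by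
  obtain ⟨c, hc, hgap⟩ := h
  refine ContinuousLinearMap.isUnit_of_forall_le_norm_inner_map _ (c := ⟨c, hc.le⟩) hc fun x => ?_
  calc ‖x‖ ^ 2 * c ≤ ⟪x, x - P x⟫_ℝ := by linarith [hgap x]
    _ ≤ ‖⟪(1 - P) x, x⟫_ℝ‖ := by
      rw [real_inner_comm]
      exact Real.le_norm_self _

theorem HasSpectralGap.exists_tendsto (h : HasSpectralGap P) (hP1 : ‖P‖ ≤ 1) (x : E) :
    ∃ v, Tendsto (fun n : ℕ => (n : ℝ)⁻¹ * ⟪x, covSum P n x⟫_ℝ) atTop (𝓝 v) := by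
  obtain ⟨u, hu⟩ := h.isUnit_one_sub
  have happly : Continuous fun T : E →L[ℝ] E => ⟪x, T x⟫_ℝ := by fun_prop
  refine ⟨_, ((happly.tendsto _).comp (tendsto_inv_smul_covSum hP1 hu)).congr fun n => ?_⟩
  simp only [Function.comp_apply, smul_apply, real_inner_smul_right]

theorem hasSpectralGap_iff_forall_exists_tendsto (hP : IsSelfAdjoint P) (hP1 : ‖P‖ ≤ 1) :
    HasSpectralGap P ↔
      ∀ x, ∃ v, Tendsto (fun n : ℕ => (n : ℝ)⁻¹ * ⟪x, covSum P n x⟫_ℝ) atTop (𝓝 v) :=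
  ⟨fun h => h.exists_tendsto hP1, hasSpectralGap_of_forall_exists_tendsto hP hP1⟩

end HilbertSpace

section TransitionOperator

variable {S : Type*} [MeasurableSpace S] {P : Kernel S S} [IsMarkovKernel P] {μ : Measure S}

theorem measurePreserving_fst_compProd (P : Kernel S S) [IsMarkovKernel P] (μ : Measure S)
    [SFinite μ] : MeasurePreserving Prod.fst (μ ⊗ₘ P) μ :=
  ⟨measurable_fst, Measure.fst_compProd μ P⟩

theorem measurePreserving_snd_compProd [SFinite μ] (hP : Kernel.Invariant P μ) :
    MeasurePreserving Prod.snd (μ ⊗ₘ P) μ :=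
  ⟨measurable_snd, (Measure.snd_compProd μ P).trans hP⟩

theorem inner_eq_integral_mul {α : Type*} [MeasurableSpace α] {ν : Measure α} (f g : Lp ℝ 2 ν) :
    ⟪f, g⟫_ℝ = ∫ x, f x * g x ∂ν := by
  simp only [L2.inner_def, RCLike.inner_apply, conj_trivial, mul_comm]

/-- The isometry `f ↦ f(X₁)` of `L²(μ)` into the functions of one step `(X₁, X₂)` of the chain
started from `μ`. -/
noncomputable def fstL2 (P : Kernel S S) [IsMarkovKernel P] (μ : Measure S) [SFinite μ] :
    Lp ℝ 2 μ →ₗᵢ[ℝ] Lp ℝ 2 (μ ⊗ₘ P) :=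
  Lp.compMeasurePreservingₗᵢ ℝ Prod.fst (measurePreserving_fst_compProd P μ)

/-- The isometry `f ↦ f(X₂)` of `L²(μ)` into the functions of one step `(X₁, X₂)` of the chain
started from its stationary distribution `μ`. -/
noncomputable def sndL2 [SFinite μ] (hP : Kernel.Invariant P μ) :
    Lp ℝ 2 μ →ₗᵢ[ℝ] Lp ℝ 2 (μ ⊗ₘ P) :=
  Lp.compMeasurePreservingₗᵢ ℝ Prod.snd (measurePreserving_snd_compProd hP)

theorem coeFn_fstL2 [SFinite μ] (f : Lp ℝ 2 μ) : fstL2 P μ f =ᵐ[μ ⊗ₘ P] fun z => f z.1 :=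
  Lp.coeFn_compMeasurePreserving f (measurePreserving_fst_compProd P μ)

theorem coeFn_sndL2 [SFinite μ] (hP : Kernel.Invariant P μ) (f : Lp ℝ 2 μ) :
    sndL2 hP f =ᵐ[μ ⊗ₘ P] fun z => f z.2 :=
  Lp.coeFn_compMeasurePreserving f (measurePreserving_snd_compProd hP)

/-- The transition operator `f ↦ ∫ y, f y ∂(P ·)` on `L²(μ)`, encoded as `f ↦ E[f(X₂) | X₁]`
through the adjoint of `f ↦ f(X₁)`; see `coeFn_transOp`. -/
noncomputable def transOp [SFinite μ] (hP : Kernel.Invariant P μ) : Lp ℝ 2 μ →L[ℝ] Lp ℝ 2 μ :=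
  (fstL2 P μ).toContinuousLinearMap.adjoint ∘L (sndL2 hP).toContinuousLinearMap

theorem inner_transOp [SFinite μ] (hP : Kernel.Invariant P μ) (f g : Lp ℝ 2 μ) :
    ⟪f, transOp hP g⟫_ℝ = ⟪fstL2 P μ f, sndL2 hP g⟫_ℝ := by
  rw [transOp, ContinuousLinearMap.comp_apply, ContinuousLinearMap.adjoint_inner_right]
  rfl

theorem norm_transOp_le [SFinite μ] (hP : Kernel.Invariant P μ) : ‖transOp hP‖ ≤ 1 := by
  calc ‖transOp hP‖
      ≤ ‖(fstL2 P μ).toContinuousLinearMap.adjoint‖ * ‖(sndL2 hP).toContinuousLinearMap‖ :=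
        ContinuousLinearMap.opNorm_comp_le _ _
    _ ≤ 1 * 1 := by
        rw [LinearIsometryEquiv.norm_map]
        gcongr <;> exact LinearIsometry.norm_toContinuousLinearMap_le _
    _ = 1 := one_mul 1

theorem coeFn_transOp [IsFiniteMeasure μ] (hP : Kernel.Invariant P μ) (f : Lp ℝ 2 μ) :
    transOp hP f =ᵐ[μ] fun x => ∫ y, f y ∂(P x) := by
  have hf : Integrable (fun z : S × S => f z.2) (μ ⊗ₘ P) :=
    (measurePreserving_snd_compProd hP).integrable_comp_of_integrable
      ((Lp.memLp f).integrable one_le_two)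
  refine Integrable.ae_eq_of_forall_setIntegral_eq _ _ ((Lp.memLp _).integrable one_le_two)
    hf.integral_compProd fun A hA hA' => ?_
  have hind : fstL2 P μ (indicatorConstLp 2 hA hA'.ne (1 : ℝ)) =
      indicatorConstLp 2 (measurable_fst hA) (measure_ne_top (μ ⊗ₘ P) _) (1 : ℝ) := rfl
  calc ∫ x in A, transOp hP f x ∂μ
      = ∫ z in Prod.fst ⁻¹' A, sndL2 hP f z ∂(μ ⊗ₘ P) := by
        rw [← L2.inner_indicatorConstLp_one (𝕜 := ℝ) hA hA'.ne, inner_transOp, hind,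
          L2.inner_indicatorConstLp_one (𝕜 := ℝ)]
    _ = ∫ z in A ×ˢ Set.univ, f z.2 ∂(μ ⊗ₘ P) := by
        rw [Set.prod_univ]
        exact setIntegral_congr_ae (measurable_fst hA)
          ((coeFn_sndL2 hP f).mono fun z hz _ => hz)
    _ = ∫ x in A, ∫ y, f y ∂(P x) ∂μ := by
        simp only [Measure.setIntegral_compProd hA MeasurableSet.univ hf.integrableOn,
          Measure.restrict_univ]

/-- The projection `f ↦ ∫ f dμ` of `L²(μ)` onto the constants. -/
noncomputable def meanProj (μ : Measure S) [IsFiniteMeasure μ] : Lp ℝ 2 μ →L[ℝ] Lp ℝ 2 μ :=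
  InnerProductSpace.rankOne ℝ (Lp.const 2 μ 1) (Lp.const 2 μ 1)

theorem inner_const_one [IsFiniteMeasure μ] (f : Lp ℝ 2 μ) :
    ⟪Lp.const 2 μ (1 : ℝ), f⟫_ℝ = ∫ x, f x ∂μ := by
  rw [← indicatorConstLp_univ, L2.inner_indicatorConstLp_one, setIntegral_univ]

theorem meanProj_apply [IsFiniteMeasure μ] (f : Lp ℝ 2 μ) :
    meanProj μ f = (∫ x, f x ∂μ) • Lp.const 2 μ (1 : ℝ) := by
  rw [meanProj, InnerProductSpace.rankOne_apply, inner_const_one]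

theorem inner_meanProj [IsFiniteMeasure μ] (f : Lp ℝ 2 μ) :
    ⟪f, meanProj μ f⟫_ℝ = (∫ x, f x ∂μ) ^ 2 := by
  rw [meanProj_apply, real_inner_smul_right, real_inner_comm, inner_const_one, pow_two]

theorem isStarProjection_meanProj [IsProbabilityMeasure μ] : IsStarProjection (meanProj μ) :=
  InnerProductSpace.isStarProjection_rankOne_self (by simp [Lp.norm_const'])

theorem sndL2_const [IsFiniteMeasure μ] (hP : Kernel.Invariant P μ) (c : ℝ) :
    sndL2 hP (Lp.const 2 μ c) = fstL2 P μ (Lp.const 2 μ c) := rfl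

theorem transOp_const [IsFiniteMeasure μ] (hP : Kernel.Invariant P μ) (c : ℝ) :
    transOp hP (Lp.const 2 μ c) = Lp.const 2 μ c :=
  ext_inner_left ℝ fun f => by
    rw [inner_transOp, sndL2_const, LinearIsometry.inner_map_map]

theorem integral_transOp [IsFiniteMeasure μ] (hP : Kernel.Invariant P μ) (f : Lp ℝ 2 μ) :
    ∫ x, transOp hP f x ∂μ = ∫ x, f x ∂μ := by
  rw [← inner_const_one, inner_transOp, ← sndL2_const hP, LinearIsometry.inner_map_map,
    inner_const_one]

theorem transOp_mul_meanProj [IsFiniteMeasure μ] (hP : Kernel.Invariant P μ) :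
    transOp hP * meanProj μ = meanProj μ := by
  ext1 f
  rw [mul_apply_eq_comp, meanProj_apply, map_smul, transOp_const]

theorem meanProj_mul_transOp [IsFiniteMeasure μ] (hP : Kernel.Invariant P μ) :
    meanProj μ * transOp hP = meanProj μ := by
  ext1 f
  rw [mul_apply_eq_comp, meanProj_apply, meanProj_apply, integral_transOp]

/-- The transition operator on the centred functions, extended by `0` to the constants. -/
noncomputable def centeredOp [IsFiniteMeasure μ] (hP : Kernel.Invariant P μ) :
    Lp ℝ 2 μ →L[ℝ] Lp ℝ 2 μ :=
  transOp hP - meanProj μ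

theorem norm_centeredOp_le [IsProbabilityMeasure μ] (hP : Kernel.Invariant P μ) :
    ‖centeredOp hP‖ ≤ 1 := by
  have hfactor : centeredOp hP = transOp hP * (1 - meanProj μ) := by
    rw [mul_sub, mul_one, transOp_mul_meanProj, centeredOp]
  calc ‖centeredOp hP‖ ≤ ‖transOp hP‖ * ‖1 - meanProj μ‖ := hfactor ▸ norm_mul_le _ _
    _ ≤ 1 * 1 := by
        gcongr
        · exact norm_transOp_le hP
        · exact isStarProjection_meanProj.one_sub.norm_le
    _ = 1 := one_mul 1

theorem centeredOp_pow_succ [IsProbabilityMeasure μ] (hP : Kernel.Invariant P μ) (n : ℕ) :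
    centeredOp hP ^ (n + 1) = transOp hP ^ (n + 1) - meanProj μ :=
  sub_pow_succ_of_mul_eq isStarProjection_meanProj.isIdempotentElem (transOp_mul_meanProj hP)
    (meanProj_mul_transOp hP) n

end TransitionOperator

section StationaryChain

variable {S : Type*} [MeasurableSpace S] {P : Kernel S S} [IsMarkovKernel P] {μ : Measure S}

theorem map_prodMap_id_compProd_comap {T T' : Type*} [MeasurableSpace T] [MeasurableSpace T']
    (ν : Measure T) [SFinite ν] (κ : Kernel T' S) [IsSFiniteKernel κ] {g : T → T'}
    (hg : Measurable g) : (ν ⊗ₘ κ.comap g hg).map (Prod.map g id) = ν.map g ⊗ₘ κ := by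
  ext A hA
  rw [Measure.map_apply (by fun_prop) hA, Measure.compProd_apply (hA.preimage (by fun_prop)),
    Measure.compProd_apply hA, lintegral_map (Kernel.measurable_kernel_prodMk_left hA) hg]
  rfl

instance [IsProbabilityMeasure μ] : IsProbabilityMeasure (chainLaw μ P) :=
  inferInstanceAs (IsProbabilityMeasure (Kernel.trajMeasure _ _))

theorem map_chainLaw_zero (P : Kernel S S) [IsMarkovKernel P] (μ : Measure S) :
    (chainLaw μ P).map (fun ω => ω 0) = μ := by
  let start : (Π _ : Finset.Iic 0, S) → S := fun w => w ⟨0, Finset.mem_Iic.2 le_rfl⟩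
  have hstart : Measurable start := measurable_pi_apply _
  have hpast : Measurable (Preorder.frestrictLe (π := fun _ : ℕ => S) 0) := by fun_prop
  have hlaw : (chainLaw μ P).map (Preorder.frestrictLe 0) =
      μ.map (MeasurableEquiv.piUnique (fun _ : Finset.Iic 0 => S)).symm := by
    rw [chainLaw, Kernel.trajMeasure, Measure.map_comp _ _ hpast,
      Kernel.traj_map_frestrictLe, Kernel.partialTraj_self, Measure.id_comp]
  calc (chainLaw μ P).map (fun ω => ω 0)
      = ((chainLaw μ P).map (Preorder.frestrictLe 0)).map start :=
        (Measure.map_map hstart hpast).symm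
    _ = μ.map id := by
        rw [hlaw, Measure.map_map hstart (MeasurableEquiv.measurable _)]
        rfl
    _ = μ := Measure.map_id

/-- The Markov property, for an observable `g` of the past that determines the transition. -/
theorem map_chainLaw_prodMk_succ [IsProbabilityMeasure μ] {T : Type*} [MeasurableSpace T] {n : ℕ}
    {g : (Π _ : Finset.Iic n, S) → T} (hg : Measurable g) (κ : Kernel T S) [IsSFiniteKernel κ]
    (hκ : ∀ w, κ (g w) = P (w ⟨n, Finset.mem_Iic.2 le_rfl⟩)) :
    (chainLaw μ P).map (fun ω => (g (Preorder.frestrictLe n ω), ω (n + 1))) =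
      (chainLaw μ P).map (fun ω => g (Preorder.frestrictLe n ω)) ⊗ₘ κ := by
  have hpast : Measurable (Preorder.frestrictLe (π := fun _ : ℕ => S) n) := by fun_prop
  have hκ' : κ.comap g hg =
      P.comap (fun w : (Π _ : Finset.Iic n, S) => w ⟨n, Finset.mem_Iic.2 le_rfl⟩)
        (measurable_pi_apply _) := Kernel.ext hκ
  calc (chainLaw μ P).map (fun ω => (g (Preorder.frestrictLe n ω), ω (n + 1)))
      = ((chainLaw μ P).map (fun ω => (Preorder.frestrictLe n ω, ω (n + 1)))).map
          (Prod.map g id) :=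
        (Measure.map_map (hg.prodMap measurable_id) (hpast.prodMk (measurable_pi_apply _))).symm
    _ = ((chainLaw μ P).map (Preorder.frestrictLe n) ⊗ₘ κ.comap g hg).map (Prod.map g id) := by
        rw [hκ', chainLaw, ← Kernel.map_frestrictLe_trajMeasure_compProd_eq_map_trajMeasure]
    _ = (chainLaw μ P).map (fun ω => g (Preorder.frestrictLe n ω)) ⊗ₘ κ := by
        rw [map_prodMap_id_compProd_comap, Measure.map_map hg hpast]
        rfl

variable [IsProbabilityMeasure μ]

theorem measurePreserving_coord (hP : Kernel.Invariant P μ) (n : ℕ) :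
    MeasurePreserving (fun ω : ℕ → S => ω n) (chainLaw μ P) μ := by
  refine ⟨measurable_pi_apply n, ?_⟩
  induction n with
  | zero => exact map_chainLaw_zero P μ
  | succ n ih =>
    have hstep : (chainLaw μ P).map (fun ω => (ω n, ω (n + 1))) = μ ⊗ₘ P :=
      (map_chainLaw_prodMk_succ (measurable_pi_apply _) P fun _ => rfl).trans
        (congrArg (· ⊗ₘ P) ih)
    calc (chainLaw μ P).map (fun ω => ω (n + 1))
        = ((chainLaw μ P).map (fun ω => (ω n, ω (n + 1)))).snd :=
          (Measure.map_map measurable_snd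
            ((measurable_pi_apply n).prodMk (measurable_pi_apply (n + 1)))).symm
      _ = μ := by rw [hstep, Measure.snd_compProd, hP.def]

theorem memLp_coord (hP : Kernel.Invariant P μ) {E : Type*}
    [NormedAddCommGroup E] {p : ℝ≥0∞} {f : S → E} (hf : MemLp f p μ) (n : ℕ) :
    MemLp (fun ω : ℕ → S => f (ω n)) p (chainLaw μ P) :=
  hf.comp_measurePreserving (measurePreserving_coord hP n)

theorem integral_coord (hP : Kernel.Invariant P μ) {E : Type*}
    [NormedAddCommGroup E] [NormedSpace ℝ E] {f : S → E} (hf : AEStronglyMeasurable f μ) (n : ℕ) :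
    ∫ ω, f (ω n) ∂(chainLaw μ P) = ∫ x, f x ∂μ := by
  have hn := measurePreserving_coord hP n
  rw [← hn.map_eq] at hf
  conv_rhs => rw [← hn.map_eq]
  exact (integral_map hn.measurable.aemeasurable hf).symm

theorem integral_coord_mul_coord_succ (hP : Kernel.Invariant P μ) {m n : ℕ} (hmn : m ≤ n)
    (f g : Lp ℝ 2 μ) :
    ∫ ω, f (ω m) * g (ω (n + 1)) ∂(chainLaw μ P) =
      ∫ ω, f (ω m) * transOp hP g (ω n) ∂(chainLaw μ P) := by
  let F : (S × S) × S → ℝ := fun z => f z.1.1 * g z.2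
  have hF : StronglyMeasurable F :=
    ((Lp.stronglyMeasurable f).comp_measurable (by fun_prop)).mul
      ((Lp.stronglyMeasurable g).comp_measurable measurable_snd)
  have hcoord : Measurable fun ω : ℕ → S => ((ω m, ω n), ω (n + 1)) := by fun_prop
  have hstep : (chainLaw μ P).map (fun ω => ((ω m, ω n), ω (n + 1))) =
      (chainLaw μ P).map (fun ω => (ω m, ω n)) ⊗ₘ Kernel.prodMkLeft S P :=
    map_chainLaw_prodMk_succ (g := fun w => (w ⟨m, Finset.mem_Iic.2 hmn⟩, w ⟨n, _⟩))
      (by fun_prop) (Kernel.prodMkLeft S P) fun _ => rfl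
  have hint : Integrable F ((chainLaw μ P).map (fun ω => ((ω m, ω n), ω (n + 1)))) :=
    (integrable_map_measure hF.aestronglyMeasurable hcoord.aemeasurable).2
      ((memLp_coord hP (Lp.memLp f) m).integrable_mul (memLp_coord hP (Lp.memLp g) (n + 1)))
  calc ∫ ω, f (ω m) * g (ω (n + 1)) ∂(chainLaw μ P)
      = ∫ z, F z ∂(chainLaw μ P).map (fun ω => ((ω m, ω n), ω (n + 1))) :=
        (integral_map hcoord.aemeasurable hF.aestronglyMeasurable).symm
    _ = ∫ ω, ∫ y, f (ω m) * g y ∂(P (ω n)) ∂(chainLaw μ P) := by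
        rw [hstep] at hint ⊢
        rw [Measure.integral_compProd hint, integral_map (by fun_prop)
          hF.integral_kernel_prod_right'.aestronglyMeasurable]
        rfl
    _ = ∫ ω, f (ω m) * transOp hP g (ω n) ∂(chainLaw μ P) := by
        refine integral_congr_ae ?_
        filter_upwards [(measurePreserving_coord hP n).quasiMeasurePreserving.ae
          (coeFn_transOp hP g)] with ω hω
        rw [hω, integral_const_mul]

theorem integral_coord_mul_coord_add (hP : Kernel.Invariant P μ) (m k : ℕ) (f g : Lp ℝ 2 μ) :
    ∫ ω, f (ω m) * g (ω (m + k)) ∂(chainLaw μ P) = ⟪f, (transOp hP ^ k) g⟫_ℝ := by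
  induction k generalizing g with
  | zero =>
    rw [inner_eq_integral_mul]
    exact integral_coord (f := fun x => f x * g x) hP
      ((Lp.aestronglyMeasurable f).mul (Lp.aestronglyMeasurable g)) m
  | succ k ih =>
    rw [← add_assoc, integral_coord_mul_coord_succ hP (Nat.le_add_right m k), ih, pow_succ,
      mul_apply_eq_comp]

theorem covariance_coord_add (hP : Kernel.Invariant P μ) (f : Lp ℝ 2 μ) (m k : ℕ) :
    cov[fun ω => f (ω m), fun ω => f (ω (m + k)); chainLaw μ P] =
      ⟪f, (transOp hP ^ k) f⟫_ℝ - (∫ x, f x ∂μ) ^ 2 := by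
  have hf := Lp.memLp f
  refine (covariance_eq_sub (memLp_coord hP hf m) (memLp_coord hP hf (m + k))).trans ?_
  rw [integral_coord hP hf.aestronglyMeasurable, integral_coord hP hf.aestronglyMeasurable,
    pow_two, ← integral_coord_mul_coord_add hP m k]
  rfl

/-- The correction on the diagonal is due to `centeredOp hP ^ 0 = 1`, which is not centred. -/
theorem covariance_coord (hP : Kernel.Invariant P μ) (f : Lp ℝ 2 μ) (i j : ℕ) :
    cov[fun ω => f (ω i), fun ω => f (ω j); chainLaw μ P] =
      ⟪f, (centeredOp hP ^ Nat.dist i j) f⟫_ℝ - if i = j then (∫ x, f x ∂μ) ^ 2 else 0 := by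
  wlog hij : i ≤ j generalizing i j
  · rw [covariance_comm, this j i (le_of_not_ge hij), Nat.dist_comm]
    simp only [eq_comm]
  obtain ⟨k, rfl⟩ := Nat.exists_eq_add_of_le hij
  rw [covariance_coord_add, Nat.dist_eq_sub_of_le hij, Nat.add_sub_cancel_left]
  cases k with
  | zero => simp only [pow_zero, add_zero, if_true]
  | succ k =>
    rw [centeredOp_pow_succ, if_neg (by omega), sub_zero, sub_apply, inner_sub_right,
      inner_meanProj]

theorem variance_sum_coord (hP : Kernel.Invariant P μ) (f : Lp ℝ 2 μ) (n : ℕ) :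
    Var[fun ω => ∑ i ∈ Finset.range n, f (ω i); chainLaw μ P] =
      ⟪f, covSum (centeredOp hP) n f⟫_ℝ - n * (∫ x, f x ∂μ) ^ 2 := by
  rw [variance_fun_sum' fun i _ => memLp_coord hP (Lp.memLp f) i]
  simp only [covariance_coord hP, Finset.sum_sub_distrib, covSum, sum_apply, inner_sum]
  congr 1
  calc ∑ i ∈ Finset.range n, ∑ j ∈ Finset.range n, (if i = j then (∫ x, f x ∂μ) ^ 2 else 0)
      = ∑ i ∈ Finset.range n, (∫ x, f x ∂μ) ^ 2 :=
        Finset.sum_congr rfl fun i hi => by rw [Finset.sum_ite_eq, if_pos hi]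
    _ = n * (∫ x, f x ∂μ) ^ 2 := by rw [Finset.sum_const, Finset.card_range, nsmul_eq_mul]

theorem mul_variance_average_coord (hP : Kernel.Invariant P μ) {h : S → ℝ} (hh : MemLp h 2 μ)
    {n : ℕ} (hn : n ≠ 0) :
    n * Var[fun ω : ℕ → S => (1 / (n : ℝ)) * ∑ i ∈ Finset.range n, h (ω i); chainLaw μ P] =
      (n : ℝ)⁻¹ * ⟪hh.toLp h, covSum (centeredOp hP) n (hh.toLp h)⟫_ℝ - (∫ x, h x ∂μ) ^ 2 := by
  have hn : (n : ℝ) ≠ 0 := Nat.cast_ne_zero.2 hn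
  have hsum : (fun ω : ℕ → S => ∑ i ∈ Finset.range n, h (ω i)) =ᵐ[chainLaw μ P]
      fun ω => ∑ i ∈ Finset.range n, hh.toLp h (ω i) := by
    have hcoord (i : ℕ) : ∀ᵐ ω ∂(chainLaw μ P), hh.toLp h (ω i) = h (ω i) :=
      (measurePreserving_coord hP i).quasiMeasurePreserving.ae hh.coeFn_toLp
    filter_upwards [ae_all_iff.2 hcoord] with ω hω
    simp only [hω]
  rw [variance_const_mul, variance_congr hsum, variance_sum_coord hP,
    integral_congr_ae hh.coeFn_toLp]
  field_simp

theorem hasAsymptoticVariance_iff (hP : Kernel.Invariant P μ) {h : S → ℝ} (hh : MemLp h 2 μ)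
    (v : ℝ) : HasAsymptoticVariance P μ h v ↔
      Tendsto (fun n : ℕ => (n : ℝ)⁻¹ * ⟪hh.toLp h, covSum (centeredOp hP) n (hh.toLp h)⟫_ℝ)
        atTop (𝓝 (v + (∫ x, h x ∂μ) ^ 2)) := by
  rw [HasAsymptoticVariance, tendsto_congr' ((eventually_ne_atTop 0).mono fun n hn =>
    mul_variance_average_coord hP hh hn), ← tendsto_add_const_iff ((∫ x, h x ∂μ) ^ 2)]
  simp only [sub_add_cancel]

theorem varianceBounding_iff_forall_exists_tendsto (hP : Kernel.Invariant P μ) :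
    VarianceBounding P μ ↔ ∀ f : Lp ℝ 2 μ, ∃ v,
      Tendsto (fun n : ℕ => (n : ℝ)⁻¹ * ⟪f, covSum (centeredOp hP) n f⟫_ℝ) atTop (𝓝 v) := by
  refine ⟨fun h f => ?_, fun h => ⟨hP, fun f hf => ?_⟩⟩
  · obtain ⟨v, hv⟩ := h.2 f (Lp.memLp f)
    rw [hasAsymptoticVariance_iff hP (Lp.memLp f), Lp.toLp_coeFn] at hv
    exact ⟨_, hv⟩
  · obtain ⟨v, hv⟩ := h (hf.toLp f)
    refine ⟨v - (∫ x, f x ∂μ) ^ 2, ?_⟩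
    rwa [hasAsymptoticVariance_iff hP hf, sub_add_cancel]

end StationaryChain

section Reversible

variable {S : Type*} [MeasurableSpace S] {P Q : Kernel S S} [IsMarkovKernel P] [IsMarkovKernel Q]
  {μ : Measure S}

theorem measurePreserving_swap_compProd [IsFiniteMeasure μ] (hP : Kernel.IsReversible P μ) :
    MeasurePreserving Prod.swap (μ ⊗ₘ P) (μ ⊗ₘ P) := by
  refine ⟨measurable_swap, Measure.ext_prod fun {A B} hA hB => ?_⟩
  rw [Measure.map_apply measurable_swap (hA.prod hB), Set.preimage_swap_prod,
    Measure.compProd_apply_prod hB hA, Measure.compProd_apply_prod hA hB]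
  exact (hP hA hB).symm

theorem inner_transOp_eq_integral [SFinite μ] (hP : Kernel.Invariant P μ) (f g : Lp ℝ 2 μ) :
    ⟪f, transOp hP g⟫_ℝ = ∫ z, f z.1 * g z.2 ∂(μ ⊗ₘ P) := by
  rw [inner_transOp, inner_eq_integral_mul]
  refine integral_congr_ae ?_
  filter_upwards [coeFn_fstL2 (P := P) f, coeFn_sndL2 hP g] with z hf hg
  rw [hf, hg]

theorem isSelfAdjoint_transOp [IsFiniteMeasure μ] (hP : Kernel.IsReversible P μ) :
    IsSelfAdjoint (transOp hP.invariant) := by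
  refine ContinuousLinearMap.isSelfAdjoint_iff_isSymmetric.2 fun f g => ?_
  calc ⟪transOp hP.invariant f, g⟫_ℝ = ∫ z, g z.1 * f z.2 ∂(μ ⊗ₘ P) := by
        rw [real_inner_comm, inner_transOp_eq_integral]
    _ = ∫ z, g z.2 * f z.1 ∂(μ ⊗ₘ P) :=
        ((measurePreserving_swap_compProd hP).integral_comp
          MeasurableEquiv.prodComm.measurableEmbedding fun z => g z.1 * f z.2).symm
    _ = ⟪f, transOp hP.invariant g⟫_ℝ := by
        simp only [inner_transOp_eq_integral, mul_comm]

/-- The Dirichlet form `𝓔(f, f) = ½ ∬ (f x - f y)² P(x, dy) μ(dx)`, the quadratic form of `1 - P`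
on `L²(μ)` if `μ` is invariant. -/
noncomputable def dirichletForm (P : Kernel S S) (μ : Measure S) (f : S → ℝ) : ℝ≥0∞ :=
  2⁻¹ * ∫⁻ z, ENNReal.ofReal ((f z.1 - f z.2) ^ 2) ∂(μ ⊗ₘ P)

theorem inner_sub_transOp [SFinite μ] (hP : Kernel.Invariant P μ) (f : Lp ℝ 2 μ) :
    ⟪f, f - transOp hP f⟫_ℝ = 2⁻¹ * ‖fstL2 P μ f - sndL2 hP f‖ ^ 2 := by
  rw [inner_sub_right, inner_transOp, norm_sub_sq_real, LinearIsometry.norm_map,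
    LinearIsometry.norm_map, real_inner_self_eq_norm_sq]
  ring

theorem ofReal_inner_sub_transOp [SFinite μ] (hP : Kernel.Invariant P μ) (f : Lp ℝ 2 μ) :
    ENNReal.ofReal ⟪f, f - transOp hP f⟫_ℝ = dirichletForm P μ f := by
  rw [inner_sub_transOp, ENNReal.ofReal_mul (by norm_num), ENNReal.ofReal_inv_of_pos two_pos,
    ENNReal.ofReal_ofNat, dirichletForm, ← real_inner_self_eq_norm_sq, L2.inner_def,
    ofReal_integral_eq_lintegral_ofReal (L2.integrable_inner _ _)
      (.of_forall fun z => real_inner_self_nonneg)]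
  congr 1
  refine lintegral_congr_ae ?_
  filter_upwards [coeFn_fstL2 (P := P) f, coeFn_sndL2 hP f,
    Lp.coeFn_sub (fstL2 P μ f) (sndL2 hP f)] with z hfst hsnd hsub
  rw [hsub, Pi.sub_apply, hfst, hsnd, real_inner_self_eq_norm_sq, Real.norm_eq_abs, sq_abs]

theorem inner_sub_transOp_le_of_dirichletForm_le [SFinite μ] (hP : Kernel.Invariant P μ)
    (hQ : Kernel.Invariant Q μ) {C : ℝ≥0} {f : Lp ℝ 2 μ}
    (h : dirichletForm P μ f ≤ C * dirichletForm Q μ f) :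
    ⟪f, f - transOp hP f⟫_ℝ ≤ C * ⟪f, f - transOp hQ f⟫_ℝ := by
  rwa [← ofReal_inner_sub_transOp hP, ← ofReal_inner_sub_transOp hQ, ← ENNReal.ofReal_coe_nnreal,
    ← ENNReal.ofReal_mul C.coe_nonneg, ENNReal.ofReal_le_ofReal_iff] at h
  rw [inner_sub_transOp]
  positivity

variable [IsProbabilityMeasure μ]

theorem inner_sub_centeredOp (hP : Kernel.Invariant P μ) (f : Lp ℝ 2 μ) :
    ⟪f, f - centeredOp hP f⟫_ℝ = ⟪f, f - transOp hP f⟫_ℝ + (∫ x, f x ∂μ) ^ 2 := by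
  rw [centeredOp, sub_apply, sub_sub_eq_add_sub, add_sub_right_comm, inner_add_right,
    inner_meanProj]

theorem varianceBounding_iff_hasSpectralGap (hP : Kernel.IsReversible P μ) :
    VarianceBounding P μ ↔ HasSpectralGap (centeredOp hP.invariant) :=
  (varianceBounding_iff_forall_exists_tendsto hP.invariant).trans
    (hasSpectralGap_iff_forall_exists_tendsto
      ((isSelfAdjoint_transOp hP).sub isStarProjection_meanProj.isSelfAdjoint)
      (norm_centeredOp_le hP.invariant)).symm

theorem VarianceBounding.of_dirichletForm_le (hP : Kernel.IsReversible P μ)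
    (hQ : Kernel.IsReversible Q μ) {C : ℝ≥0}
    (hle : ∀ f : S → ℝ, Measurable f → dirichletForm P μ f ≤ C * dirichletForm Q μ f)
    (h : VarianceBounding P μ) : VarianceBounding Q μ := by
  rw [varianceBounding_iff_hasSpectralGap hP] at h
  rw [varianceBounding_iff_hasSpectralGap hQ]
  refine h.of_inner_sub_le (K := 1 + C) (by positivity) fun f => ?_
  have hform := inner_sub_transOp_le_of_dirichletForm_le hP.invariant hQ.invariant
    (hle f (Lp.stronglyMeasurable f).measurable)
  have hnonneg : 0 ≤ ⟪f, f - transOp hQ.invariant f⟫_ℝ := by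
    rw [inner_sub_transOp]
    positivity
  have hmean : 0 ≤ C * (∫ x, f x ∂μ) ^ 2 := by positivity
  rw [inner_sub_centeredOp, inner_sub_centeredOp]
  linarith

end Reversible

section ProposeAcceptReject

variable {S : Type*} [MeasureSpace S]

/-- The density `π(x) q(x, y) α(x, y)` of the accepted moves from `x` to `y` in stationarity. -/
def flux (π : Density S) (q : Proposal S) (α : Acceptance S) (x y : S) : ℝ :=
  π x * (q x y * α x y)

theorem flux_nonneg (π : Density S) (q : Proposal S) (α : Acceptance S) (x y : S) :
    0 ≤ flux π q α x y :=
  mul_nonneg (π.nonneg x) (mul_nonneg (q.nonneg x y) (α.nonneg x y))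

theorem measurable_flux (π : Density S) (q : Proposal S) (α : Acceptance S) :
    Measurable fun z : S × S => flux π q α z.1 z.2 :=
  (π.measurable.comp measurable_fst).mul (q.measurable.mul α.measurable)

theorem measurable_mul_accept (q : Proposal S) (α : Acceptance S) :
    Measurable fun z : S × S => q z.1 z.2 * α z.1 z.2 :=
  q.measurable.mul α.measurable

theorem isProbabilityMeasure_toMeasure {π : Density S} (hπ : ∫ x, π x = 1) :
    IsProbabilityMeasure π.toMeasure := by
  have hint : Integrable π := .of_integral_ne_zero (hπ ▸ one_ne_zero)
  refine ⟨?_⟩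
  rw [Density.toMeasure, withDensity_apply _ MeasurableSet.univ, Measure.restrict_univ,
    ← ofReal_integral_eq_lintegral_ofReal hint (.of_forall π.nonneg), hπ, ENNReal.ofReal_one]

variable [SFinite (volume : Measure S)]

instance (π : Density S) : SFinite π.toMeasure :=
  inferInstanceAs (SFinite (volume.withDensity _))

theorem kernel_apply (q : Proposal S) (α : Acceptance S) (x : S) :
    kernel q α x = volume.withDensity (fun y => ENNReal.ofReal (q x y * α x y)) +
      ENNReal.ofReal (1 - ∫ y, q x y * α x y) • Measure.dirac x := rfl

theorem lintegral_kernel (q : Proposal S) (α : Acceptance S) (x : S) {g : S → ℝ≥0∞}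
    (hg : Measurable g) :
    ∫⁻ y, g y ∂(kernel q α x) = (∫⁻ y, ENNReal.ofReal (q x y * α x y) * g y) +
      ENNReal.ofReal (1 - ∫ y, q x y * α x y) * g x := by
  have hacc : Measurable fun y => ENNReal.ofReal (q x y * α x y) :=
    ((measurable_mul_accept q α).comp measurable_prodMk_left).ennreal_ofReal
  rw [kernel_apply, lintegral_add_measure, lintegral_smul_measure, lintegral_dirac' _ hg,
    lintegral_withDensity_eq_lintegral_mul _ hacc hg]
  rfl

theorem lintegral_compProd_kernel (π : Density S) (q : Proposal S) (α : Acceptance S)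
    {F : S × S → ℝ≥0∞} (hF : Measurable F) :
    ∫⁻ z, F z ∂(π.toMeasure ⊗ₘ kernel q α) =
      (∫⁻ x, ∫⁻ y, ENNReal.ofReal (flux π q α x y) * F (x, y)) +
        ∫⁻ x, ENNReal.ofReal (1 - ∫ y, q x y * α x y) * F (x, x) ∂π.toMeasure := by
  have hmeas : Measurable fun x => ∫⁻ y, ENNReal.ofReal (q x y * α x y) * F (x, y) :=
    ((measurable_mul_accept q α).ennreal_ofReal.mul hF).lintegral_prod_right'
  have hflux (x : S) : ENNReal.ofReal (π x) * ∫⁻ y, ENNReal.ofReal (q x y * α x y) * F (x, y) =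
      ∫⁻ y, ENNReal.ofReal (flux π q α x y) * F (x, y) := by
    simp only [← lintegral_const_mul' _ _ ENNReal.ofReal_ne_top, flux,
      ENNReal.ofReal_mul (π.nonneg x), mul_assoc]
  have hstep (x : S) : ∫⁻ y, F (x, y) ∂(kernel q α x) =
      (∫⁻ y, ENNReal.ofReal (q x y * α x y) * F (x, y)) +
        ENNReal.ofReal (1 - ∫ y, q x y * α x y) * F (x, x) :=
    lintegral_kernel q α x (hF.comp measurable_prodMk_left)
  rw [Measure.lintegral_compProd hF]
  simp only [hstep]
  rw [lintegral_add_left hmeas]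
  congr 1
  rw [Density.toMeasure, lintegral_withDensity_eq_lintegral_mul _ π.measurable.ennreal_ofReal hmeas]
  exact lintegral_congr hflux

theorem lintegral_swap_compProd_kernel {π : Density S} {q : Proposal S} {α : Acceptance S}
    (h : ∀ x y, flux π q α x y = flux π q α y x) {F : S × S → ℝ≥0∞} (hF : Measurable F) :
    ∫⁻ z, F z.swap ∂(π.toMeasure ⊗ₘ kernel q α) = ∫⁻ z, F z ∂(π.toMeasure ⊗ₘ kernel q α) := by
  have hswap : Measurable fun z : S × S => F z.swap := hF.comp measurable_swap
  have hmeas : Measurable fun z : S × S => ENNReal.ofReal (flux π q α z.1 z.2) * F z.swap :=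
    (measurable_flux π q α).ennreal_ofReal.mul hswap
  rw [lintegral_compProd_kernel π q α hswap, lintegral_compProd_kernel π q α hF]
  simp only [Prod.swap_prod_mk]
  rw [lintegral_lintegral_swap hmeas.aemeasurable]
  simp only [h]

theorem isReversible_kernel {π : Density S} {q : Proposal S} {α : Acceptance S}
    (h : ∀ x y, flux π q α x y = flux π q α y x) :
    Kernel.IsReversible (kernel q α) π.toMeasure := by
  intro A B hA hB
  rw [← Measure.compProd_apply_prod hA hB, ← Measure.compProd_apply_prod hB hA,
    ← lintegral_indicator_one (hA.prod hB), ← lintegral_indicator_one (hB.prod hA),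
    ← lintegral_swap_compProd_kernel h (measurable_one.indicator (hA.prod hB))]
  refine lintegral_congr fun z => ?_
  rw [← Set.preimage_swap_prod]
  rfl

theorem dirichletForm_kernel (π : Density S) (q : Proposal S) (α : Acceptance S) {f : S → ℝ}
    (hf : Measurable f) :
    dirichletForm (kernel q α) π.toMeasure f = 2⁻¹ * ∫⁻ x, ∫⁻ y,
      ENNReal.ofReal (flux π q α x y) * ENNReal.ofReal ((f x - f y) ^ 2) := by
  rw [dirichletForm, lintegral_compProd_kernel π q α (by fun_prop)]
  simp

theorem dirichletForm_kernel_le {π : Density S} {q : Proposal S} {α β : Acceptance S} {C : ℝ}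
    (hle : ∀ x y, flux π q α x y ≤ C * flux π q β x y) {f : S → ℝ} (hf : Measurable f) :
    dirichletForm (kernel q α) π.toMeasure f ≤
      C.toNNReal * dirichletForm (kernel q β) π.toMeasure f := by
  have hflux (x y : S) : ENNReal.ofReal (flux π q α x y) * ENNReal.ofReal ((f x - f y) ^ 2) ≤
      C.toNNReal * (ENNReal.ofReal (flux π q β x y) * ENNReal.ofReal ((f x - f y) ^ 2)) := by
    rw [← mul_assoc]
    gcongr
    exact (ENNReal.ofReal_le_ofReal (hle x y)).trans_eq
      (ENNReal.ofReal_mul' (flux_nonneg π q β x y))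
  rw [dirichletForm_kernel π q α hf, dirichletForm_kernel π q β hf, mul_left_comm]
  gcongr
  simp only [← lintegral_const_mul' _ _ ENNReal.coe_ne_top]
  exact lintegral_mono fun x => lintegral_mono (hflux x)

theorem VarianceBounding.of_flux_le {π : Density S} [IsProbabilityMeasure π.toMeasure]
    {q : Proposal S} {α β : Acceptance S} {C : ℝ}
    (hα : ∀ x y, flux π q α x y = flux π q α y x) (hβ : ∀ x y, flux π q β x y = flux π q β y x)
    (hle : ∀ x y, flux π q α x y ≤ C * flux π q β x y)
    (h : VarianceBounding (kernel q α) π.toMeasure) :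
    VarianceBounding (kernel q β) π.toMeasure :=
  h.of_dirichletForm_le (isReversible_kernel hα) (isReversible_kernel hβ)
    fun _ hf => dirichletForm_kernel_le hle hf

end ProposeAcceptReject

section MetropolisHastings

variable {S : Type*} [MeasureSpace S]

theorem mul_min_one_div {a b : ℝ} (ha : 0 ≤ a) (hb : 0 ≤ b) : a * min 1 (b / a) = min a b := by
  rcases ha.eq_or_lt with rfl | ha
  · rw [zero_mul, min_eq_left hb]
  · rw [mul_min_of_nonneg _ _ ha.le, mul_one, mul_div_cancel₀ _ ha.ne']

theorem flux_acceptMH (π : Density S) (q : Proposal S) (x y : S) :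
    flux π q (acceptMH π q) x y = min (π x * q x y) (π y * q y x) := by
  rw [flux, ← mul_assoc]
  exact mul_min_one_div (mul_nonneg (π.nonneg x) (q.nonneg x y))
    (mul_nonneg (π.nonneg y) (q.nonneg y x))

theorem flux_acceptMH_comm (π : Density S) (q : Proposal S) (x y : S) :
    flux π q (acceptMH π q) x y = flux π q (acceptMH π q) y x := by
  rw [flux_acceptMH, flux_acceptMH, min_comm]

theorem flux_acceptDA (π πhat : Density S) (q : Proposal S) (x y : S) :
    flux π q (acceptDA π πhat q) x y =
      flux πhat q (acceptMH πhat q) x y * min (π x / πhat x) (π y / πhat y) := by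
  have hcorrection : π x / πhat x * min 1 (ratioCorrection π πhat x y) =
      min (π x / πhat x) (π y / πhat y) :=
    mul_min_one_div (div_nonneg (π.nonneg x) (πhat.nonneg x))
      (div_nonneg (π.nonneg y) (πhat.nonneg y))
  rw [← hcorrection]
  change π x * (q x y * (min 1 (ratioMH πhat q x y) * min 1 (ratioCorrection π πhat x y))) =
    πhat x * (q x y * min 1 (ratioMH πhat q x y)) *
      (π x / πhat x * min 1 (ratioCorrection π πhat x y))
  rcases eq_or_ne (πhat x) 0 with hx | hx
  · simp [ratioMH, hx]
  · field_simp

theorem flux_acceptDA_comm (π πhat : Density S) (q : Proposal S) (x y : S) :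
    flux π q (acceptDA π πhat q) x y = flux π q (acceptDA π πhat q) y x := by
  rw [flux_acceptDA, flux_acceptDA, flux_acceptMH_comm, min_comm]

theorem mul_flux_acceptMH_le {π πhat : Density S} {c : ℝ} (hc : 0 ≤ c)
    (h : ∀ x, c * π x ≤ πhat x) (q : Proposal S) (x y : S) :
    c * flux π q (acceptMH π q) x y ≤ flux πhat q (acceptMH πhat q) x y := by
  rw [flux_acceptMH, flux_acceptMH, mul_min_of_nonneg _ _ hc, ← mul_assoc, ← mul_assoc]
  exact min_le_min (mul_le_mul_of_nonneg_right (h x) (q.nonneg x y))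
    (mul_le_mul_of_nonneg_right (h y) (q.nonneg y x))

theorem flux_acceptMH_le_mul_flux_acceptDA {π πhat : Density S} {γlo γhi : ℝ} (hlo : 0 < γlo)
    (h : ∀ x, 0 < π x → γlo ≤ πhat x / π x ∧ πhat x / π x ≤ γhi) (q : Proposal S) (x y : S) :
    flux π q (acceptMH π q) x y ≤ γhi / γlo * flux π q (acceptDA π πhat q) x y := by
  have hscreen (x : S) : γlo * π x ≤ πhat x := by
    rcases (π.nonneg x).eq_or_lt with hx | hx
    · rw [← hx, mul_zero]
      exact πhat.nonneg x
    · exact (le_div_iff₀ hx).1 (h x hx).1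
  have hcorrection {x : S} (hx : 0 < π x) : γhi⁻¹ ≤ π x / πhat x := by
    rw [← inv_div (πhat x)]
    exact inv_anti₀ (hlo.trans_le (h x hx).1) (h x hx).2
  rcases (π.nonneg x).eq_or_lt with hx | hx
  · simp only [flux, ← hx, zero_mul, mul_zero, le_refl]
  rcases (π.nonneg y).eq_or_lt with hy | hy
  · rw [flux_acceptMH_comm, flux_acceptDA_comm]
    simp only [flux, ← hy, zero_mul, mul_zero, le_refl]
  have hhi : 0 < γhi := hlo.trans_le ((h x hx).1.trans (h x hx).2)
  rw [div_mul_eq_mul_div, le_div_iff₀ hlo, ← inv_mul_le_iff₀ hhi, mul_comm _ γlo, mul_comm,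
    flux_acceptDA]
  exact mul_le_mul (mul_flux_acceptMH_le hlo.le hscreen q x y)
    (le_min (hcorrection hx) (hcorrection hy)) (inv_nonneg.2 hhi.le) (flux_nonneg _ _ _ _ _)

end MetropolisHastings

end DelayedAcceptance

theorem corollary2_general {S : Type*} [MeasureSpace S] [SFinite (volume : Measure S)]
    (π πhat : DelayedAcceptance.Density S) (hπ : ∫ x, π x = 1)
    (q : DelayedAcceptance.Proposal S)
    (hγ : ∃ γlo γhi : ℝ, 0 < γlo ∧
      ∀ x, 0 < π x → γlo ≤ πhat x / π x ∧ πhat x / π x ≤ γhi)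
    (hMH : DelayedAcceptance.VarianceBounding (DelayedAcceptance.kernelMH π q) π.toMeasure) :
    DelayedAcceptance.VarianceBounding (DelayedAcceptance.kernelDA π πhat q) π.toMeasure := by
  obtain ⟨γlo, γhi, hlo, h⟩ := hγ
  have := DelayedAcceptance.isProbabilityMeasure_toMeasure hπ
  exact DelayedAcceptance.VarianceBounding.of_flux_le (DelayedAcceptance.flux_acceptMH_comm π q)
    (DelayedAcceptance.flux_acceptDA_comm π πhat q)
    (DelayedAcceptance.flux_acceptMH_le_mul_flux_acceptDA hlo h q) hMH

theorem corollary2 {d : ℕ} (X : Set (EuclideanSpace ℝ (Fin d)))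
    (hX : NullMeasurableSet X volume)
    (π πhat : DelayedAcceptance.Density (DelayedAcceptance.StateSpace X))
    (hπ : ∫ x, π x = 1)
    (q : DelayedAcceptance.Proposal (DelayedAcceptance.StateSpace X))
    (hγ : ∃ γlo γhi : ℝ, 0 < γlo ∧
      ∀ x, 0 < π x → γlo ≤ πhat x / π x ∧ πhat x / π x ≤ γhi)
    (hMH : DelayedAcceptance.VarianceBounding
      (DelayedAcceptance.kernelMH π q) π.toMeasure) :
    DelayedAcceptance.VarianceBounding
      (DelayedAcceptance.kernelDA π πhat q) π.toMeasure :=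
  corollary2_general π πhat hπ q hγ hMH
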